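/- **Setting.** Let $k\ge 1$, let $\alpha\in C^1([0,2\pi])$ with $\alpha(0)=\alpha(2\pi)$ ($\alpha$ may vanish and change sign), and consider $u_t+(\alpha u)_x=g$ on $[0,2\pi]\times[0,T]$, $T>0$, with periodic boundary conditions, where $g(\cdot,t)$ is integrable for every $t$. For a mesh $0=x_{1/2}<x_{3/2}<\dots<x_{N+1/2}=2\pi$, $N\ge1$, put $\mathbf V_i=[x_{i-1/2},x_{i+1/2}]$, $h_i=x_{i+1/2}-x_{i-1/2}$, and let $V_h$ be the space of functions that are polynomials of degree at most $k$ on each $\mathbf V_i$; $v^\pm$ are one-sided limits, indices are periodic ($\mathbf V_{N+1}=\mathbf V_1$, $\mathbf V_0=\mathbf V_N$). The mesh is shape-regular with constant $\rho$ if $\max_j h_j\le\rho h_i$ for all $i$. Each $\mathbf V_i$ is divided into $k+1$ control volumes $[x_{i,j},x_{i,j+1}]$, $0\le j\le k$, by $x_{i,j}=\frac{h_i}{2}s_j+\frac12(x_{i-1/2}+x_{i+1/2})$, where $-1=s_0<s_1<\dots<s_{k+1}=1$ may depend on $i$. With $L_n$ the Legendre polynomials: * LSV: on every $\mathbf V_i$,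 $s_1,\dots,s_k$ are the Gauss–Legendre points (zeros of $L_k$). * RSV: on every $\mathbf V_i$, either $s_1,\dots,s_{k+1}$ are the right Radau points (zeros of $L_{k+1}-L_k$), or $s_0,\dots,s_k$ are the left Radau points (zeros of $L_{k+1}+L_k$). They are the right ones if $\alpha(x_{i-1/2})>0$ and $\alpha(x_{i+1/2})>0$, the left ones if $\alpha(x_{i-1/2})<0$ and $\alpha(x_{i+1/2})<0$, and an arbitrary choice of one of the two otherwise. The numerical flux is $\hat v(x_{i+1/2})=v^-(x_{i+1/2})$ if $\alpha(x_{i+1/2})>0$ and $v^+(x_{i+1/2})$ otherwise (at $0$ and $2\pi$ the same value, by periodicity), and $\hat v(x_{i,j})=v(x_{i,j})$ for $1\le j\le k$. For $v\in V_h$ depending differentiably on time and a piecewise constant $w^*$ with the value $w^*_{i,j}$ on $[x_{i,j},x_{i,j+1}]$ let $$a_h(v,w^*)=\sum_{i=1}^N\sum_{j=0}^k w^*_{i,j}\Big(\int_{x_{i,j}}^{x_{i,j+1}}v_t\,dx+(\alpha\hat v)(x_{i,j+1})-(\alpha\hat v)(x_{i,j})\Big).$$ A solution of the scheme is a function $u_h:[0,T]\to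 V_h$, differentiable in time, with $a_h(u_h,w^*)=(g,w^*)$ for all $t\in[0,T]$ and all such $w^*$, where $(f,w^*)=\sum_{i,j}w^*_{i,j}\int_{x_{i,j}}^{x_{i,j+1}}f\,dx$. For $w\in V_h$ let $w^*$ be the piecewise constant $$w^*_{i,0}=w^+(x_{i-1/2})+A_{i,0}w_x(x_{i,0}),\qquad w^*_{i,j}=w^*_{i,j-1}+A_{i,j}w_x(x_{i,j})\quad(1\le j\le k),$$ where derivatives at end points are taken from inside $\mathbf V_i$, $A_{i,j}=\frac{h_i}{2}A_j$, and $A_j$ is the weight of $s_j$ in the interpolatory quadrature on $[-1,1]$ with the chosen Gauss or Radau points ($A_j=0$ if $s_j$ is not one of these points). Let $\|v\|_0$ be the $L^2(0,2\pi)$ norm, $|||v|||=(v,v^*)^{1/2}$, and $\|v\|_E=\|v\|_0$ for RSV, $\|v\|_E=|||v|||$ for LSV. **Theorem.** Let the scheme be RSV or LSV. Constants $C$ below do not depend on the mesh, on the choice of points in RSV, on $g$ or on the solution. 1. There is a constant $C$ with $\|v\|_0\le C\|v\|_E$ and $\|v\|_E\le C\|v\|_0$ for all meshes and all $v\in V_h$.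 2. For every $\rho$ there is a constant $C$, independent of $T$, such that for all meshes that are shape-regular with constant $\rho$, every solution $u_h$ of the scheme (for any $g$) and every $t\in[0,T]$, $\|u_h\|_E^2$ is differentiable at $t$ (one-sidedly at the end points) and $$\frac12\frac{d}{dt}\|u_h\|_E^2\le-\frac12(\alpha_xu_h,u_h)+a_h(u_h,u_h^*)+C\|u_h\|_0^2 .$$ 3. For every $\rho$ and every $T>0$ there is a constant $C$ such that for all meshes that are shape-regular with constant $\rho$ and every solution $u_h$ of the scheme with $g=0$, $$\|u_h(\cdot,t)\|_E\le C\,\|u_h(\cdot,0)\|_E,\qquad t\in[0,T].$$ -/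

import Mathlib

open Set Polynomial
open scoped Polynomial

noncomputable section

namespace SV

/-- The Legendre polynomial `L_n`, by Rodrigues' formula
`L_n = (1 / (2^n n!)) dⁿ/dxⁿ (x² - 1)ⁿ`. -/
def legendre (n : ℕ) : ℝ[X] :=
  C (1 / (2 ^ n * (n.factorial : ℝ))) * derivative^[n] ((X ^ 2 - 1) ^ n)

/-- The three families of partition points of the reference element `[-1, 1]`. -/
inductive NodeFamily
  | gauss
  | rightRadau
  | leftRadau

/-- The polynomial whose zeros are the quadrature points of a family:
`L_k` (Gauss-Legendre), `L_{k+1} - L_k` (right Radau), `L_{k+1} + L_k` (left Radau). -/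
def NodeFamily.poly (k : ℕ) : NodeFamily → ℝ[X]
  | .gauss => legendre k
  | .rightRadau => legendre (k + 1) - legendre k
  | .leftRadau => legendre (k + 1) + legendre k

/-- The indices `j ∈ {0, …, k+1}` of those `s_j` that are quadrature points:
`1, …, k` (Gauss-Legendre), `1, …, k+1` (right Radau), `0, …, k` (left Radau). -/
def NodeFamily.indices (k : ℕ) : NodeFamily → Finset (Fin (k + 2))
  | .gauss => (Finset.univ.erase 0).erase (Fin.last (k + 1))
  | .rightRadau => Finset.univ.erase 0
  | .leftRadau => Finset.univ.erase (Fin.last (k + 1))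

/-- `-1 = s_0 < s_1 < ⋯ < s_{k+1} = 1`, where the `s_j` that belong to the family are zeros of
the polynomial of the family (hence all of its zeros, their number being its degree). -/
structure IsReferencePartition {k : ℕ} (F : NodeFamily) (s : Fin (k + 2) → ℝ) : Prop where
  strictMono : StrictMono s
  first : s 0 = -1
  last : s (Fin.last (k + 1)) = 1
  isRoot : ∀ j ∈ F.indices k, (F.poly k).IsRoot (s j)

/-- The weight `A_j = ∫_{-1}^{1} l_j` of the interpolatory quadrature on the points of the family,
`l_j` being the Lagrange basis function at `s_j`; `A_j = 0` if `s_j` is not a quadrature point. -/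
def weight {k : ℕ} (F : NodeFamily) (s : Fin (k + 2) → ℝ) (j : Fin (k + 2)) : ℝ :=
  if j ∈ F.indices k then ∫ y in (-1 : ℝ)..1, (Lagrange.basis (F.indices k) s j).eval y else 0

/-- A mesh of `[0, 2π]` with `N` elements, each of which is divided into `k + 1` control volumes
by Gauss-Legendre, right Radau or left Radau points.
Element number `i : Fin N` is `[node i.castSucc, node i.succ]`. -/
structure Discretization (k N : ℕ) where
  node : Fin (N + 1) → ℝ
  node_strictMono : StrictMono node
  node_first : node 0 = 0
  node_last : node (Fin.last N) = 2 * Real.pi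
  family : Fin N → NodeFamily
  ref : Fin N → Fin (k + 2) → ℝ
  ref_spec : ∀ i, IsReferencePartition (family i) (ref i)

/-- A function that is a polynomial on each of the `N` elements, with no continuity between the
elements (so that its one-sided limits at a node are values of the two adjacent polynomials). -/
abbrev PiecewisePoly (N : ℕ) := Fin N → ℝ[X]

/-- A function that is constant on each control volume, given by its values `w*_{i,j}`. -/
abbrev PiecewiseConst (k N : ℕ) := Fin N → Fin (k + 1) → ℝ

/-- The finite element space `V_h`: degree at most `k` on each element. -/
def MemVh (k : ℕ) {N : ℕ} (v : PiecewisePoly N) : Prop :=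
  ∀ i, (v i).natDegree ≤ k

namespace Discretization

variable {k N : ℕ} (D : Discretization k N)

/-- Left end point `x_{i-1/2}` of element `i`. -/
def left (i : Fin N) : ℝ := D.node i.castSucc

/-- Right end point `x_{i+1/2}` of element `i`. -/
def right (i : Fin N) : ℝ := D.node i.succ

/-- Length `h_i` of element `i`. -/
def len (i : Fin N) : ℝ := D.right i - D.left i

/-- The partition point `x_{i,j}`. -/
def pt (i : Fin N) (j : Fin (k + 2)) : ℝ :=
  D.len i / 2 * D.ref i j + (D.left i + D.right i) / 2

/-- `max_j h_j ≤ ρ h_i` for all `i`. -/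
def ShapeRegular (ρ : ℝ) : Prop := ∀ i j, D.len j ≤ ρ * D.len i

/-- `LSV`: Gauss-Legendre points in every element. -/
def IsLSV : Prop := ∀ i, D.family i = .gauss

/-- `RSV`: right Radau points if `α > 0` at both ends of the element, left Radau points if `α < 0`
at both ends, and an arbitrary choice of one of the two otherwise. -/
def IsRSV (α : ℝ → ℝ) : Prop :=
  ∀ i, (D.family i = .rightRadau ∨ D.family i = .leftRadau) ∧
    (0 < α (D.left i) → 0 < α (D.right i) → D.family i = .rightRadau) ∧
    (α (D.left i) < 0 → α (D.right i) < 0 → D.family i = .leftRadau)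

/-- The upwind numerical flux value `v̂` at the right end `x_{i+1/2}` of element `i`; the element
following the last one is the first one (`i + 1` is taken modulo `N`), by periodicity. -/
def upwind [NeZero N] (α : ℝ → ℝ) (v : PiecewisePoly N) (i : Fin N) : ℝ :=
  if 0 < α (D.right i) then (v i).eval (D.right i) else (v (i + 1)).eval (D.left (i + 1))

/-- The flux `α v̂` at `x_{i,j}`: upwind at the two ends of the element (the left end of element
`i` being the right end of element `i - 1`, modulo `N`), and `α v` at the interior points. -/
def flux [NeZero N] (α : ℝ → ℝ) (v : PiecewisePoly N) (i : Fin N) (j : Fin (k + 2)) : ℝ :=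
  if j = 0 then α (D.left i) * D.upwind α v (i - 1)
  else if j = Fin.last (k + 1) then α (D.right i) * D.upwind α v i
  else α (D.pt i j) * (v i).eval (D.pt i j)

/-- `(f, w*) = ∑_{i,j} w*_{i,j} ∫_{x_{i,j}}^{x_{i,j+1}} f dx`, where `f` is given on each element. -/
def innerConst (f : Fin N → ℝ → ℝ) (w : PiecewiseConst k N) : ℝ :=
  ∑ i, ∑ j : Fin (k + 1), w i j * (∫ x in (D.pt i j.castSucc)..(D.pt i j.succ), f i x)

/-- The spectral volume form `a_h(v, w*)`; as `v` depends on time, it takes the value `v` and the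
time derivative `vt` at the time under consideration. -/
def form [NeZero N] (α : ℝ → ℝ) (v vt : PiecewisePoly N) (w : PiecewiseConst k N) : ℝ :=
  ∑ i, (∑ j : Fin (k + 1),
      w i j * (∫ x in (D.pt i j.castSucc)..(D.pt i j.succ), (vt i).eval x) +
    ∑ j : Fin (k + 1), w i j * (D.flux α v i j.succ - D.flux α v i j.castSucc))

/-- The transformation `w ↦ w* = T w`:
`w*_{i,0} = w(x_{i-1/2}⁺) + A_{i,0} w_x(x_{i,0})`, `w*_{i,j} = w*_{i,j-1} + A_{i,j} w_x(x_{i,j})`,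
with `A_{i,j} = (h_i / 2) A_j`; the recurrence is written as a sum. -/
def star (w : PiecewisePoly N) : PiecewiseConst k N := fun i j =>
  (w i).eval (D.left i) + ∑ m ∈ Finset.Iic j,
    D.len i / 2 * weight (D.family i) (D.ref i) m.castSucc *
      (derivative (w i)).eval (D.pt i m.castSucc)

/-- `(c v, v) = ∫_0^{2π} c v² dx`. -/
def weightedSq (c : ℝ → ℝ) (v : PiecewisePoly N) : ℝ :=
  ∑ i, ∫ x in (D.left i)..(D.right i), c x * (v i).eval x ^ 2

/-- The `L²(0, 2π)` norm. -/
def l2Norm (v : PiecewisePoly N) : ℝ := √(D.weightedSq (fun _ => 1) v)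

/-- The norm `|||v||| = (v, v*)^{1/2}`. -/
def starNorm (v : PiecewisePoly N) : ℝ :=
  √(D.innerConst (fun i x => (v i).eval x) (D.star v))

/-- `(u, ut)` is a solution of the semi-discrete scheme on `[0, T]` with its time derivative:
`u(·, t) ∈ V_h`, `u` is differentiable in time with derivative `ut`, and
`a_h(u, w*) = (g, w*)` for every piecewise constant `w*` and every `t ∈ [0, T]`. -/
structure IsSolution [NeZero N] (α : ℝ → ℝ) (T : ℝ) (g : ℝ → ℝ → ℝ)
    (u ut : ℝ → PiecewisePoly N) : Prop where
  mem : ∀ t ∈ Icc 0 T, MemVh k (u t)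
  hasDeriv : ∀ t ∈ Icc 0 T, ∀ i m,
    HasDerivWithinAt (fun s => (u s i).coeff m) ((ut t i).coeff m) (Icc 0 T) t
  scheme : ∀ t ∈ Icc 0 T, ∀ w : PiecewiseConst k N,
    D.form α (u t) (ut t) w = D.innerConst (fun _ x => g x t) w

end Discretization

/-- The two spectral volume schemes. -/
inductive Scheme
  | RSV
  | LSV

/-- The discretization is one for the given scheme. -/
def Scheme.Admits (α : ℝ → ℝ) {k N : ℕ} (D : Discretization k N) : Scheme → Prop
  | .RSV => D.IsRSV α
  | .LSV => D.IsLSV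

/-- The energy norm `‖·‖_E`: the `L²` norm for `RSV`, the norm `|||·|||` for `LSV`. -/
def Scheme.energyNorm {k N : ℕ} (D : Discretization k N) (v : PiecewisePoly N) : Scheme → ℝ
  | .RSV => D.l2Norm v
  | .LSV => D.starNorm v

end SV

end

/-!
Everything is reduced to the reference element `[-1, 1]`. Summation by parts turns the test with
the piecewise constant `q*` into an integration by parts in which the integral of `q' G` is replaced
by the Gauss or Radau quadrature (`IsReferencePartition.sum_refStar_mul_sub`). By Rodrigues' formula
the nodal polynomial of `n ∈ {k, k + 1}` points is orthogonal to all polynomials of degree `< k`, so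
that the quadrature is exact up to degree `n + k - 1` (`IsReferencePartition.quad_eval`); hence its
weights are nonnegative and have sum `2`.

Norms. With `P` a primitive of `p`, the form `(p, q*)` is `∫ p q` plus the quadrature error of
`q' P`, a polynomial of degree `2k`. The error vanishes for Radau points; for Gauss points it is
`c p_k q_k` with leading coefficients `p_k`, `q_k` and `0 ≤ c q_k² ≤ ∫ q²`
(`IsReferencePartition.exists_refMass_eq`). So `(·, ·*)` is symmetric on `V_h`, the energy of both
schemes is `(v, v*)`, and `‖v‖₀² ≤ (v, v*) ≤ 2 ‖v‖₀²`.

Energy inequality. By symmetry half the time derivative of the energy is `(u_t, u*)`, that is,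
`a_h(u, u*)` minus the flux terms, and only a bound of the negative flux terms by `C ‖u‖₀²` is
needed; `(α_x u, u)` is itself of this size. In an element of length `h`, freezing `α` at an end
point changes the terms by `O(h)` times products of values of `q` and `q'`, which inverse
inequalities bound by `‖u‖₀²` on the element, and for frozen `α` the quadrature of `α q q'` is exact
(`neg_sum_refStar_flux_le`). Summed over the elements, the terms at an interface are the upwind
dissipation `-|α| [u]² / 2`. For Radau points there remain terms at those ends of the element that
are quadrature points but where the numerical flux is not the inner trace. The choice of the points
guarantees that `α` then has a zero in the element, so that `|α| = O(h)` there
(`Discretization.abs_le_of_admits`), and half of the dissipation absorbs these terms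
(`upwind_dissipation`). As the jumps are absorbed rather than estimated, neighbouring elements are
never compared, and the constants do not depend on the shape regularity of the mesh.

Stability follows by testing with `u*` and Gronwall's inequality.
-/

noncomputable section

namespace SV

/-! ### Integrals of polynomials over the reference element -/

theorem integral_eval_derivative (P : ℝ[X]) (a b : ℝ) :
    ∫ y in a..b, (derivative P).eval y = P.eval b - P.eval a :=
  intervalIntegral.integral_eq_sub_of_hasDerivAt (fun y _ => P.hasDerivAt y)
    ((derivative P).continuous.intervalIntegrable _ _)

theorem exists_derivative_eq (p : ℝ[X]) : ∃ P : ℝ[X], derivative P = p := by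
  induction p using Polynomial.induction_on' with
  | add p q hp hq =>
    obtain ⟨P, rfl⟩ := hp
    obtain ⟨Q, rfl⟩ := hq
    exact ⟨P + Q, derivative_add⟩
  | monomial n a =>
    refine ⟨monomial (n + 1) (a / (n + 1)), ?_⟩
    have : (n : ℝ) + 1 ≠ 0 := by positivity
    rw [derivative_monomial]
    simp [div_mul_cancel₀ a this]

theorem natDegree_le_of_natDegree_derivative_le {P : ℝ[X]} {n : ℕ}
    (h : (derivative P).natDegree ≤ n) : P.natDegree ≤ n + 1 := by
  rw [natDegree_le_iff_coeff_eq_zero] at h ⊢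
  intro m hm
  obtain ⟨m, rfl⟩ : ∃ l, m = l + 1 := ⟨m - 1, by omega⟩
  have := h m (by omega)
  rw [coeff_derivative] at this
  exact (mul_eq_zero.1 this).resolve_right (by positivity)

/-- The integral of a polynomial over `[-1, 1]`, as a linear functional. -/
def refIntegral : ℝ[X] →ₗ[ℝ] ℝ where
  toFun p := ∫ y in (-1 : ℝ)..1, p.eval y
  map_add' p q := by
    simp only [eval_add]
    exact intervalIntegral.integral_add (p.continuous.intervalIntegrable _ _)
      (q.continuous.intervalIntegrable _ _)
  map_smul' c p := by
    simp only [eval_smul, smul_eq_mul, RingHom.id_apply]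
    exact intervalIntegral.integral_const_mul _ _

theorem refIntegral_apply (p : ℝ[X]) : refIntegral p = ∫ y in (-1 : ℝ)..1, p.eval y := rfl

theorem refIntegral_derivative (P : ℝ[X]) :
    refIntegral (derivative P) = P.eval 1 - P.eval (-1) :=
  integral_eval_derivative P _ _

theorem refIntegral_sq_nonneg (p : ℝ[X]) : 0 ≤ refIntegral (p ^ 2) :=
  intervalIntegral.integral_nonneg (by norm_num) fun y _ => by
    rw [eval_pow]; positivity

theorem refIntegral_sq_pos {p : ℝ[X]} (hp : p ≠ 0) : 0 < refIntegral (p ^ 2) := by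
  rcases (refIntegral_sq_nonneg p).lt_or_eq with h | h
  · exact h
  exfalso
  -- a polynomial whose square has integral zero vanishes at infinitely many points
  have h0 : ∀ y ∈ Ioo (-1 : ℝ) 1, p.eval y = 0 := by
    intro y hy
    by_contra hne
    have hpos : 0 < ∫ y in (-1 : ℝ)..1, (p ^ 2).eval y :=
      intervalIntegral.integral_pos (by norm_num) (p ^ 2).continuous.continuousOn
        (fun x _ => by rw [eval_pow]; positivity)
        ⟨y, Ioo_subset_Icc_self hy, by rw [eval_pow]; positivity⟩
    exact hpos.ne h
  exact hp (eq_zero_of_infinite_isRoot p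
    ((Ioo_infinite (by norm_num : (-1 : ℝ) < 1)).mono fun y hy => h0 y hy))

/-! ### Legendre polynomials -/

theorem isRoot_iterate_derivative_sq_sub_one_pow {m n : ℕ} (h : m < n) {y : ℝ}
    (hy : y ^ 2 = 1) : (derivative^[m] ((X ^ 2 - 1 : ℝ[X]) ^ n)).eval y = 0 := by
  obtain ⟨q, hq⟩ := pow_sub_dvd_iterate_derivative_pow (X ^ 2 - 1 : ℝ[X]) n m
  rw [hq, eval_mul, eval_pow]
  simp [hy, Nat.sub_ne_zero_of_lt h]

/-- Integration by parts in Rodrigues' formula, moving `m` derivatives on the other factor. -/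
theorem refIntegral_iterate_derivative_mul {m n : ℕ} (h : m ≤ n) (q : ℝ[X]) :
    refIntegral (derivative^[n] ((X ^ 2 - 1) ^ n) * q) =
      (-1) ^ m * refIntegral (derivative^[n - m] ((X ^ 2 - 1) ^ n) * derivative^[m] q) := by
  induction m with
  | zero => simp
  | succ m ih =>
    rw [ih (by omega)]
    set p := derivative^[n - (m + 1)] ((X ^ 2 - 1 : ℝ[X]) ^ n) with hp
    set r := derivative^[m] q
    have h1 : derivative^[n - m] ((X ^ 2 - 1 : ℝ[X]) ^ n) = derivative p := by
      rw [hp, ← Function.iterate_succ_apply' (⇑derivative)]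
      congr 2; omega
    have h2 : derivative^[m + 1] q = derivative r := Function.iterate_succ_apply' _ _ _
    have h3 := refIntegral_derivative (p * r)
    rw [derivative_mul, map_add, eval_mul, eval_mul, hp,
      isRoot_iterate_derivative_sq_sub_one_pow (by omega) (by norm_num),
      isRoot_iterate_derivative_sq_sub_one_pow (by omega) (by norm_num), ← hp] at h3
    rw [h1, h2, eq_neg_of_add_eq_zero_left (h3.trans (by ring)), pow_succ]
    ring

theorem refIntegral_legendre_mul {n : ℕ} {q : ℝ[X]} (hq : q.natDegree < n) :
    refIntegral (legendre n * q) = 0 := by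
  rw [legendre, mul_assoc, ← smul_eq_C_mul, map_smul,
    refIntegral_iterate_derivative_mul le_rfl, iterate_derivative_eq_zero hq]
  simp

theorem natDegree_sq_sub_one_pow (n : ℕ) : ((X ^ 2 - 1 : ℝ[X]) ^ n).natDegree = n * 2 := by
  rw [natDegree_pow]
  congr 1
  simpa using natDegree_X_pow_sub_C (R := ℝ) (n := 2) (r := 1)

theorem monic_sq_sub_one_pow (n : ℕ) : ((X ^ 2 - 1 : ℝ[X]) ^ n).Monic := by
  refine Monic.pow ?_ n
  simpa using monic_X_pow_sub_C (R := ℝ) (n := 2) 1 (by norm_num)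

theorem natDegree_legendre_le (n : ℕ) : (legendre n).natDegree ≤ n := by
  refine (natDegree_C_mul_le _ _).trans ((natDegree_iterate_derivative _ _).trans ?_)
  rw [natDegree_sq_sub_one_pow]; omega

theorem coeff_legendre_ne_zero (n : ℕ) : (legendre n).coeff n ≠ 0 := by
  have h : ((X ^ 2 - 1 : ℝ[X]) ^ n).coeff (n + n) = 1 := by
    have := (monic_sq_sub_one_pow n).coeff_natDegree
    rwa [natDegree_sq_sub_one_pow, mul_two] at this
  rw [legendre, coeff_C_mul, coeff_iterate_derivative, h]
  have : (n + n).descFactorial n ≠ 0 := by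
    rw [Ne, Nat.descFactorial_eq_zero_iff_lt]; omega
  simp only [nsmul_eq_mul, mul_one]
  positivity

namespace NodeFamily

variable (F : NodeFamily) (k : ℕ)

/-- The number `n` of quadrature points. -/
def size : NodeFamily → ℕ
  | .gauss => k
  | .rightRadau => k + 1
  | .leftRadau => k + 1

theorem card_indices : (F.indices k).card = F.size k := by
  have : (0 : Fin (k + 2)) ≠ Fin.last (k + 1) := (Fin.last_pos).ne
  cases F <;> simp [indices, size, Finset.card_erase_of_mem, this.symm]

theorem le_size : k ≤ F.size k := by cases F <;> simp [size]

theorem size_le : F.size k ≤ k + 1 := by cases F <;> simp [size]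

theorem natDegree_poly_le : (F.poly k).natDegree ≤ F.size k := by
  have h1 := natDegree_legendre_le k
  have h2 := natDegree_legendre_le (k + 1)
  cases F
  · exact h1
  · exact (natDegree_sub_le _ _).trans (max_le h2 (h1.trans k.le_succ))
  · exact (natDegree_add_le _ _).trans (max_le h2 (h1.trans k.le_succ))

theorem coeff_poly_ne_zero : (F.poly k).coeff (F.size k) ≠ 0 := by
  have h1 : (legendre k).coeff (k + 1) = 0 :=
    coeff_eq_zero_of_natDegree_lt ((natDegree_legendre_le k).trans_lt k.lt_succ_self)
  cases F
  · exact coeff_legendre_ne_zero k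
  · simpa [poly, size, h1] using coeff_legendre_ne_zero (k + 1)
  · simpa [poly, size, h1] using coeff_legendre_ne_zero (k + 1)

variable {k}

theorem refIntegral_poly_mul {q : ℝ[X]} (hq : q.natDegree < k) :
    refIntegral (F.poly k * q) = 0 := by
  have h1 := refIntegral_legendre_mul hq
  have h2 := refIntegral_legendre_mul (hq.trans k.lt_succ_self)
  cases F
  · exact h1
  · rw [poly, sub_mul, map_sub, h1, h2, sub_zero]
  · rw [poly, add_mul, map_add, h1, h2, add_zero]

end NodeFamily

/-! ### Gauss and Radau quadrature -/

/-- The interpolatory quadrature `∑_j A_j f(s_j)` on the reference element. -/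
def quad {k : ℕ} (F : NodeFamily) (s : Fin (k + 2) → ℝ) (f : Fin (k + 2) → ℝ) : ℝ :=
  ∑ j, weight F s j * f j

namespace IsReferencePartition

variable {k : ℕ} {F : NodeFamily} {s : Fin (k + 2) → ℝ}

theorem mem_Icc (hs : IsReferencePartition F s) (j : Fin (k + 2)) : s j ∈ Icc (-1 : ℝ) 1 :=
  ⟨hs.first ▸ hs.strictMono.monotone (Fin.zero_le j),
    hs.last ▸ hs.strictMono.monotone (Fin.le_last j)⟩

theorem injOn (hs : IsReferencePartition F s) (S : Set (Fin (k + 2))) : InjOn s S :=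
  hs.strictMono.injective.injOn

theorem quad_eq_sum_indices (f : Fin (k + 2) → ℝ) :
    quad F s f = ∑ j ∈ F.indices k, weight F s j * f j := by
  refine (Finset.sum_subset (Finset.subset_univ _) fun j _ hj => ?_).symm
  rw [weight, if_neg hj, zero_mul]

theorem quad_eval_of_lt (hs : IsReferencePartition F s) {p : ℝ[X]}
    (hp : p.degree < F.size k) : quad F s (fun j => p.eval (s j)) = refIntegral p := by
  rw [← F.card_indices k] at hp
  conv_rhs => rw [Lagrange.eq_interpolate (hs.injOn _) hp, Lagrange.interpolate_apply, map_sum]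
  rw [quad_eq_sum_indices]
  refine Finset.sum_congr rfl fun j hj => ?_
  rw [← smul_eq_C_mul, map_smul, weight, if_pos hj, smul_eq_mul, mul_comm, refIntegral_apply]

/-- The polynomial of the family is a multiple of the nodal polynomial, having the same roots. -/
theorem exists_poly_eq (hs : IsReferencePartition F s) :
    ∃ c : ℝ, c ≠ 0 ∧ F.poly k = C c * Lagrange.nodal (F.indices k) s := by
  set c := (F.poly k).coeff (F.size k)
  have hc : c ≠ 0 := F.coeff_poly_ne_zero k
  refine ⟨c, hc, ?_⟩
  have hn : (C c * Lagrange.nodal (F.indices k) s).natDegree = F.size k := by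
    rw [natDegree_C_mul hc, Lagrange.natDegree_nodal, F.card_indices]
  refine eq_of_degree_sub_lt_of_eval_index_eq (F.indices k) (hs.injOn _) ?_ ?_
  · rw [F.card_indices, degree_lt_iff_coeff_zero]
    intro m hm
    rcases hm.lt_or_eq with h | rfl
    · rw [coeff_sub, coeff_eq_zero_of_natDegree_lt ((F.natDegree_poly_le k).trans_lt h),
        coeff_eq_zero_of_natDegree_lt (hn.trans_lt h), sub_zero]
    · rw [coeff_sub, coeff_C_mul, ← F.card_indices k, ← Lagrange.natDegree_nodal (v := s),
        Lagrange.nodal_monic.coeff_natDegree, Lagrange.natDegree_nodal, F.card_indices]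
      simp [c]
  · intro j hj
    rw [hs.isRoot j hj, eval_mul, Lagrange.eval_nodal_at_node hj, mul_zero]

theorem refIntegral_nodal_mul (hs : IsReferencePartition F s) {q : ℝ[X]}
    (hq : q.natDegree < k) : refIntegral (Lagrange.nodal (F.indices k) s * q) = 0 := by
  obtain ⟨c, hc, h⟩ := hs.exists_poly_eq
  have h1 := F.refIntegral_poly_mul hq
  rw [h, mul_assoc, ← smul_eq_C_mul, map_smul, smul_eq_mul] at h1
  exact (mul_eq_zero.1 h1).resolve_left hc

/-- Division by the nodal polynomial reduces a quadrature error to the integral of a multiple of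
the nodal polynomial. -/
theorem refIntegral_sub_quad (hs : IsReferencePartition F s) (p : ℝ[X]) :
    refIntegral p - quad F s (fun j => p.eval (s j)) =
      refIntegral (Lagrange.nodal (F.indices k) s * (p /ₘ Lagrange.nodal (F.indices k) s)) := by
  set ω := Lagrange.nodal (F.indices k) s with hω
  have hm : ω.Monic := Lagrange.nodal_monic
  have hdeg : (p %ₘ ω).degree < F.size k := by
    refine (degree_modByMonic_lt p hm).trans_eq ?_
    rw [hω, Lagrange.degree_nodal, F.card_indices]
  have hquad : quad F s (fun j => p.eval (s j)) = quad F s (fun j => (p %ₘ ω).eval (s j)) := by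
    rw [quad_eq_sum_indices, quad_eq_sum_indices]
    refine Finset.sum_congr rfl fun j hj => ?_
    conv_lhs => rw [← modByMonic_add_div p ω]
    rw [eval_add, eval_mul, hω, Lagrange.eval_nodal_at_node hj, zero_mul, add_zero]
  have hint := congrArg refIntegral (modByMonic_add_div p ω)
  rw [map_add] at hint
  rw [hquad, hs.quad_eval_of_lt hdeg, ← hint, add_sub_cancel_left]

/-- The quadrature with `n ∈ {k, k + 1}` points is exact up to degree `n + k - 1`. -/
theorem quad_eval (hs : IsReferencePartition F s) {p : ℝ[X]}
    (hp : p.natDegree < F.size k + k) : quad F s (fun j => p.eval (s j)) = refIntegral p := by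
  have hk := F.le_size k
  refine (sub_eq_zero.1 ((hs.refIntegral_sub_quad p).trans ?_)).symm
  rcases Nat.eq_zero_or_pos k with rfl | hkpos
  · rw [(divByMonic_eq_zero_iff Lagrange.nodal_monic).2, mul_zero, map_zero]
    rw [Lagrange.degree_nodal, F.card_indices]
    exact degree_le_natDegree.trans_lt (by exact_mod_cast hp)
  · refine hs.refIntegral_nodal_mul ?_
    rw [natDegree_divByMonic _ Lagrange.nodal_monic, Lagrange.natDegree_nodal, F.card_indices]
    omega

theorem weight_nonneg (hk : 1 ≤ k) (hs : IsReferencePartition F s) (j : Fin (k + 2)) :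
    0 ≤ weight F s j := by
  by_cases hj : j ∈ F.indices k
  · have hd : (Lagrange.basis (F.indices k) s j).natDegree = F.size k - 1 := by
      rw [Lagrange.natDegree_basis (hs.injOn _) hj, F.card_indices]
    have h := hs.quad_eval (p := Lagrange.basis (F.indices k) s j ^ 2) (by
      rw [natDegree_pow, hd]
      have := F.size_le k; have := F.le_size k; omega)
    rw [quad_eq_sum_indices, Finset.sum_eq_single_of_mem j hj] at h
    · rw [eval_pow, Lagrange.eval_basis_self (hs.injOn _) hj, one_pow, mul_one] at h
      exact h ▸ refIntegral_sq_nonneg _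
    · intro i hi hij
      rw [eval_pow, Lagrange.eval_basis_of_ne hij.symm hi]
      ring
  · rw [weight, if_neg hj]

theorem sum_weight (hk : 1 ≤ k) (hs : IsReferencePartition F s) : ∑ j, weight F s j = 2 := by
  have h := hs.quad_eval (p := 1) (by rw [natDegree_one]; omega)
  simp only [quad, eval_one, mul_one] at h
  rw [h, refIntegral_apply]
  norm_num

theorem weight_le_two (hk : 1 ≤ k) (hs : IsReferencePartition F s) (j : Fin (k + 2)) :
    weight F s j ≤ 2 :=
  hs.sum_weight hk ▸ Finset.single_le_sum (fun i _ => hs.weight_nonneg hk i) (Finset.mem_univ j)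

end IsReferencePartition

/-! ### The transformation to piecewise constants on the reference element -/

/-- The values `q(-1) + ∑_{m ≤ j} A_m q'(s_m)` of the piecewise constant `q*` that belongs to a
polynomial `q` on the reference element. -/
def refStar {k : ℕ} (F : NodeFamily) (s : Fin (k + 2) → ℝ) (q : ℝ[X]) (j : Fin (k + 1)) : ℝ :=
  q.eval (-1) + ∑ m ∈ Finset.Iic j, weight F s m.castSucc * (derivative q).eval (s m.castSucc)

/-- The form `(p, q*)` on the reference element. -/
def refMass {k : ℕ} (F : NodeFamily) (s : Fin (k + 2) → ℝ) (p q : ℝ[X]) : ℝ :=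
  ∑ j : Fin (k + 1), refStar F s q j * ∫ y in (s j.castSucc)..(s j.succ), p.eval y

/-- Summation by parts against the increments of `G`. -/
theorem sum_partial_sum_mul_sub {n : ℕ} (c : ℝ) (a : Fin (n + 1) → ℝ) (G : Fin (n + 2) → ℝ) :
    ∑ j : Fin (n + 1), (c + ∑ m ∈ Finset.Iic j, a m) * (G j.succ - G j.castSucc) =
      (c + ∑ m, a m) * G (Fin.last (n + 1)) - c * G 0 - ∑ m, a m * G m.castSucc := by
  have htel : ∀ (l : ℕ) (H : Fin (l + 1) → ℝ),
      ∑ j : Fin l, (H j.succ - H j.castSucc) = H (Fin.last l) - H 0 := by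
    intro l H
    have h1 := Fin.sum_univ_succ H
    have h2 := Fin.sum_univ_castSucc H
    rw [Finset.sum_sub_distrib]
    linarith
  induction n with
  | zero =>
    have h : Finset.Iic (0 : Fin (0 + 1)) = Finset.univ := Finset.Iic_top
    simp [h]
    ring
  | succ n ih =>
    rw [Fin.sum_univ_castSucc]
    have h : ∀ j : Fin (n + 1), ∑ m ∈ Finset.Iic j.castSucc, a m =
        ∑ m ∈ Finset.Iic j, a m.castSucc := by
      intro j
      rw [← Fin.map_castSuccEmb_Iic, Finset.sum_map]
      rfl
    have hl : Finset.Iic (Fin.last (n + 1)) = Finset.univ := Finset.Iic_top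
    simp only [h, hl]
    have := ih (fun m => a m.castSucc) (fun m => G m.castSucc)
    simp only [Fin.succ_castSucc] at this ⊢
    rw [this, Fin.sum_univ_castSucc (f := a), Fin.sum_univ_castSucc (f := fun m => a m * _)]
    simp only [Fin.castSucc_zero, Fin.succ_last]
    ring

namespace IsReferencePartition

variable {k : ℕ} {F : NodeFamily} {s : Fin (k + 2) → ℝ}

/-- Testing increments with `q*` amounts to an integration by parts in which the integral of
`q' G` is computed by quadrature. -/
theorem sum_refStar_mul_sub (hk : 1 ≤ k) (hs : IsReferencePartition F s) {q : ℝ[X]}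
    (hq : q.natDegree ≤ k) (G : Fin (k + 2) → ℝ) :
    ∑ j : Fin (k + 1), refStar F s q j * (G j.succ - G j.castSucc) =
      q.eval 1 * G (Fin.last (k + 1)) - q.eval (-1) * G 0 -
        quad F s (fun j => (derivative q).eval (s j) * G j) := by
  have h := hs.quad_eval (p := derivative q) (by
    have := natDegree_derivative_le q; omega)
  rw [refIntegral_derivative, quad, Fin.sum_univ_castSucc, hs.last] at h
  unfold refStar
  rw [sum_partial_sum_mul_sub, quad,
    Fin.sum_univ_castSucc (f := fun j => weight F s j * (eval (s j) (derivative q) * G j)), hs.last]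
  simp only [mul_assoc]
  linear_combination G (Fin.last (k + 1)) * h

theorem refMass_eq_add (hk : 1 ≤ k) (hs : IsReferencePartition F s) (P : ℝ[X]) {q : ℝ[X]}
    (hq : q.natDegree ≤ k) :
    refMass F s (derivative P) q = refIntegral (derivative P * q) +
      (refIntegral (derivative q * P) -
        quad F s (fun j => (derivative q * P).eval (s j))) := by
  have h := hs.sum_refStar_mul_sub hk hq (fun j => P.eval (s j))
  have h2 := refIntegral_derivative (P * q)
  rw [derivative_mul, map_add, eval_mul, eval_mul, mul_comm P] at h2
  simp only [refMass, integral_eval_derivative, eval_mul]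
  rw [h, hs.first, hs.last]
  linarith

/-- The form `(p, q*)` is the `L²` product plus a multiple of the product of the leading
coefficients: the quadrature error, which is present only for the Gauss points, where the
integrand `q' P` has degree `2k`, and which is at most the `L²` product when `p = q`. -/
theorem exists_refMass_eq (hk : 1 ≤ k) (hs : IsReferencePartition F s) :
    ∃ c : ℝ, 0 ≤ c ∧ (F ≠ .gauss → c = 0) ∧
      (∀ p q : ℝ[X], p.natDegree ≤ k → q.natDegree ≤ k →
        refMass F s p q = refIntegral (p * q) + c * (p.coeff k * q.coeff k)) ∧
      ∀ q : ℝ[X], q.natDegree ≤ k → c * q.coeff k ^ 2 ≤ refIntegral (q ^ 2) := by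
  by_cases hF : F = .gauss
  swap
  · refine ⟨0, le_rfl, fun _ => rfl, fun p q hp hq => ?_, fun q _ => ?_⟩
    · obtain ⟨P, rfl⟩ := exists_derivative_eq p
      have hP := natDegree_le_of_natDegree_derivative_le hp
      have hsize : F.size k = k + 1 := by cases F <;> simp_all [NodeFamily.size]
      have hd : (derivative q * P).natDegree < F.size k + k := by
        have := natDegree_derivative_le q
        have := natDegree_mul_le (p := derivative q) (q := P)
        omega
      rw [hs.refMass_eq_add hk P hq, hs.quad_eval hd]
      ring
    · rw [zero_mul]; exact refIntegral_sq_nonneg q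
  · subst hF
    set ω := Lagrange.nodal (NodeFamily.gauss.indices k) s with hω
    have hm : ω.Monic := Lagrange.nodal_monic
    have hdeg : ω.natDegree = k := by
      rw [hω, Lagrange.natDegree_nodal, NodeFamily.card_indices, NodeFamily.size]
    have hcoeff : ω.coeff k = 1 := hdeg ▸ hm.coeff_natDegree
    -- removing the right multiple of the monic `ω` leaves a polynomial orthogonal to `ω`
    have hlow : ∀ q : ℝ[X], q.natDegree ≤ k → (q - q.coeff k • ω).natDegree < k := by
      intro q hq
      refine Nat.lt_of_le_pred hk (natDegree_le_iff_coeff_eq_zero.2 fun m hmk => ?_)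
      rcases (Nat.le_of_pred_lt hmk).lt_or_eq with h | rfl
      · rw [coeff_sub, coeff_smul, coeff_eq_zero_of_natDegree_lt (hq.trans_lt h),
          coeff_eq_zero_of_natDegree_lt (hdeg.trans_lt h), smul_zero, sub_zero]
      · rw [coeff_sub, coeff_smul, hcoeff, smul_eq_mul, mul_one, sub_self]
    have horth : ∀ q : ℝ[X], q.natDegree ≤ k →
        refIntegral (ω * q) = q.coeff k * refIntegral (ω ^ 2) := by
      intro q hq
      have h := hs.refIntegral_nodal_mul (hlow q hq)
      rw [← hω, mul_sub, map_sub, mul_smul_comm, map_smul, smul_eq_mul, ← sq] at h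
      linarith
    set κ := refIntegral (ω ^ 2)
    have hκ : 0 ≤ κ := refIntegral_sq_nonneg ω
    have hk0 : (0 : ℝ) < k := by exact_mod_cast hk
    refine ⟨k / (k + 1) * κ, by positivity, fun h => (h rfl).elim,
      fun p q hp hq => ?_, fun q hq => ?_⟩
    · obtain ⟨P, rfl⟩ := exists_derivative_eq p
      have hP := natDegree_le_of_natDegree_derivative_le hp
      have hq' := (natDegree_derivative_le q).trans (Nat.sub_le_sub_right hq 1)
      obtain ⟨l, rfl⟩ : ∃ l, k = l + 1 := ⟨k - 1, by omega⟩
      rw [Nat.add_sub_cancel] at hq'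
      have hd := natDegree_mul_le_of_le hq' hP
      have hdiv : (derivative q * P /ₘ ω).natDegree ≤ l + 1 := by
        rw [natDegree_divByMonic _ hm, hdeg]; omega
      have htop : (derivative q * P /ₘ ω).coeff (l + 1) =
          (derivative q).coeff l * P.coeff (l + 1 + 1) := by
        rw [← coeff_mul_add_eq_of_natDegree_le hq' hP]
        have h := congrArg (fun r => coeff r (l + (l + 1 + 1)))
          (modByMonic_add_div (derivative q * P) ω)
        have hr : (derivative q * P %ₘ ω).coeff (l + (l + 1 + 1)) = 0 :=
          coeff_eq_zero_of_natDegree_lt ((natDegree_modByMonic_le _ hm).trans_lt (by omega))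
        have hsplit : l + (l + 1 + 1) = (l + 1) + (l + 1) := by ring
        simp only [coeff_add, hr, zero_add] at h
        rw [hsplit, coeff_mul_add_eq_of_natDegree_le hdeg.le hdiv, hcoeff, one_mul] at h
        simpa [hsplit] using h
      rw [hs.refMass_eq_add hk P hq, hs.refIntegral_sub_quad, ← hω, horth _ hdiv, htop,
        coeff_derivative, coeff_derivative]
      push_cast
      have : (l : ℝ) + 1 + 1 ≠ 0 := by positivity
      field_simp
    · have h1 : q ^ 2 = (q.coeff k • ω) ^ 2 + (2 * q.coeff k) • (ω * (q - q.coeff k • ω)) +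
          (q - q.coeff k • ω) ^ 2 := by
        simp only [smul_eq_C_mul, C_mul, C_ofNat]
        ring
      have h2 : refIntegral (q ^ 2) =
          q.coeff k ^ 2 * κ + refIntegral ((q - q.coeff k • ω) ^ 2) := by
        conv_lhs => rw [h1]
        rw [map_add, map_add, map_smul, hs.refIntegral_nodal_mul (hlow q hq), _root_.smul_pow, map_smul]
        simp only [smul_eq_mul, mul_zero, add_zero, κ]
      have h3 := refIntegral_sq_nonneg (q - q.coeff k • ω)
      have h4 : (k : ℝ) / (k + 1) ≤ 1 := by rw [div_le_one (by positivity)]; linarith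
      have h5 := mul_le_mul_of_nonneg_right h4 (mul_nonneg hκ (sq_nonneg (q.coeff k)))
      rw [h2]
      linarith

end IsReferencePartition

/-! ### Inverse inequalities on the reference element -/

theorem exists_coeff_sq_le (k : ℕ) : ∃ C : ℝ, 0 ≤ C ∧ ∀ q : ℝ[X], q.natDegree ≤ k →
    ∀ m, |q.coeff m| ^ 2 ≤ C * refIntegral (q ^ 2) := by
  -- the `L²` norm is positive and continuous on the unit sphere of the coefficient space
  set f : (Fin (k + 1) → ℝ) → ℝ :=
    fun a => ∫ y in (-1 : ℝ)..1, (∑ i, a i * y ^ (i : ℕ)) ^ 2 with hf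
  set P : (Fin (k + 1) → ℝ) → ℝ[X] := fun a => ∑ i, C (a i) * X ^ (i : ℕ) with hP
  have hPf : ∀ a, refIntegral (P a ^ 2) = f a := by
    intro a
    simp [refIntegral_apply, hf, hP, eval_finsetSum]
  have hPc : ∀ a i, (P a).coeff (i : Fin (k + 1)) = a i := by
    intro a i
    simp [hP, coeff_C_mul, coeff_X_pow, Fin.val_inj]
  have hcont : Continuous f := by
    apply intervalIntegral.continuous_parametric_intervalIntegral_of_continuous'
    fun_prop
  obtain ⟨a₀, ha₀, hmin⟩ := (isCompact_sphere (0 : Fin (k + 1) → ℝ) 1).exists_isMinOn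
    (NormedSpace.sphere_nonempty.2 zero_le_one) hcont.continuousOn
  have hpos : 0 < f a₀ := by
    rw [← hPf]
    refine refIntegral_sq_pos fun h => ?_
    have : a₀ = 0 := by
      ext i
      rw [← hPc a₀ i, h]; simp
    simp [this] at ha₀
  refine ⟨(f a₀)⁻¹, by positivity, fun q hq m => ?_⟩
  have hq0 : 0 ≤ (f a₀)⁻¹ * refIntegral (q ^ 2) :=
    mul_nonneg (by positivity) (refIntegral_sq_nonneg q)
  by_cases hm : m < k + 1
  swap
  · rw [coeff_eq_zero_of_natDegree_lt (by omega)]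
    simpa using hq0
  set a : Fin (k + 1) → ℝ := fun i => q.coeff i with ha
  have hqP : q = P a := by
    conv_lhs => rw [as_sum_range_C_mul_X_pow' (p := q) (n := k + 1) (by omega)]
    rw [hP, ← Fin.sum_univ_eq_sum_range (fun i => C (q.coeff i) * X ^ i)]
  have hle : |q.coeff m| ≤ ‖a‖ := by
    simpa [ha] using norm_le_pi_norm a ⟨m, hm⟩
  rcases eq_or_ne a 0 with h0 | h0
  · have : q.coeff m = 0 := by simpa [h0] using hle
    rw [this]
    simpa using hq0
  have hn : 0 < ‖a‖ := norm_pos_iff.2 h0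
  have hscale : f (‖a‖⁻¹ • a) = (‖a‖⁻¹) ^ 2 * f a := by
    simp only [hf, Pi.smul_apply, smul_eq_mul, mul_assoc, ← Finset.mul_sum, mul_pow]
    exact intervalIntegral.integral_const_mul _ _
  have hmin' : f a₀ ≤ f (‖a‖⁻¹ • a) := hmin (by
    simp [norm_smul, inv_mul_cancel₀ hn.ne'])
  rw [hscale, inv_pow, inv_mul_eq_div, le_div_iff₀ (by positivity)] at hmin'
  rw [hqP, hPf, ← hqP, inv_mul_eq_div, le_div_iff₀ hpos]
  calc |q.coeff m| ^ 2 * f a₀ ≤ ‖a‖ ^ 2 * f a₀ := by gcongr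
    _ ≤ f a := by linarith

theorem exists_eval_sq_le (k : ℕ) : ∃ C : ℝ, 0 ≤ C ∧ ∀ q : ℝ[X], q.natDegree ≤ k →
    ∀ y ∈ Icc (-1 : ℝ) 1, q.eval y ^ 2 ≤ C * refIntegral (q ^ 2) ∧
      (derivative q).eval y ^ 2 ≤ C * refIntegral (q ^ 2) := by
  obtain ⟨C, hC, h⟩ := exists_coeff_sq_le k
  refine ⟨(k + 1) ^ 4 * C, by positivity, fun q hq y hy => ?_⟩
  have hy1 : |y| ≤ 1 := abs_le.2 hy
  set B := √(C * refIntegral (q ^ 2))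
  have hB : B ^ 2 = C * refIntegral (q ^ 2) :=
    Real.sq_sqrt (mul_nonneg hC (refIntegral_sq_nonneg q))
  have hc : ∀ m, |q.coeff m| ≤ B := fun m => Real.le_sqrt_of_sq_le (h q hq m)
  have hB0 : 0 ≤ B := Real.sqrt_nonneg _
  have hpow : ∀ m : ℕ, |y| ^ m ≤ 1 := fun m => pow_le_one₀ (abs_nonneg y) hy1
  have key : ∀ p : ℝ[X], p.natDegree ≤ k → (∀ m ≤ k, |p.coeff m| ≤ (k + 1) * B) →
      p.eval y ^ 2 ≤ (k + 1) ^ 4 * C * refIntegral (q ^ 2) := by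
    intro p hp hpc
    have h1 : |p.eval y| ≤ (k + 1) * ((k + 1) * B) := by
      rw [eval_eq_sum_range' (n := k + 1) (by omega)]
      refine (Finset.abs_sum_le_sum_abs _ _).trans ?_
      refine (Finset.sum_le_card_nsmul _ _ ((k + 1) * B) fun m hm => ?_).trans (by simp)
      rw [abs_mul, abs_pow]
      exact (mul_le_of_le_one_right (abs_nonneg _) (hpow m)).trans
        (hpc m (by simpa [Nat.lt_succ_iff] using hm))
    calc p.eval y ^ 2 = |p.eval y| ^ 2 := (sq_abs _).symm
      _ ≤ ((k + 1) * ((k + 1) * B)) ^ 2 := by gcongr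
      _ = (k + 1) ^ 4 * C * refIntegral (q ^ 2) := by linear_combination (k + 1 : ℝ) ^ 4 * hB
  refine ⟨key q hq fun m _ => (hc m).trans (le_mul_of_one_le_left hB0 (by simp)),
    key _ ((natDegree_derivative_le q).trans (by omega)) fun m hm => ?_⟩
  rw [coeff_derivative, abs_mul, mul_comm, abs_of_nonneg (by positivity : (0 : ℝ) ≤ m + 1)]
  gcongr
  exact hc _

/-! ### Scaling to the reference element, and the energy -/

namespace Discretization

variable {k N : ℕ} (D : Discretization k N)

theorem left_lt_right (i : Fin N) : D.left i < D.right i :=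
  D.node_strictMono i.castSucc_lt_succ

theorem len_pos (i : Fin N) : 0 < D.len i := sub_pos.2 (D.left_lt_right i)

theorem node_mem (l : Fin (N + 1)) : D.node l ∈ Icc 0 (2 * Real.pi) :=
  ⟨D.node_first ▸ D.node_strictMono.monotone (Fin.zero_le l),
    D.node_last ▸ D.node_strictMono.monotone (Fin.le_last l)⟩

/-- The polynomial `p` on element `i`, as a polynomial in the variable of the reference element. -/
def toRef (i : Fin N) (p : ℝ[X]) : ℝ[X] :=
  p.comp (C (D.len i / 2) * X + C ((D.left i + D.right i) / 2))

theorem natDegree_toRef_le (i : Fin N) (p : ℝ[X]) : (D.toRef i p).natDegree ≤ p.natDegree :=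
  (natDegree_comp_le).trans (mul_le_of_le_one_right (Nat.zero_le _) natDegree_linear_le)

theorem eval_toRef (i : Fin N) (p : ℝ[X]) (y : ℝ) :
    (D.toRef i p).eval y = p.eval (D.len i / 2 * y + (D.left i + D.right i) / 2) := by
  simp [toRef, eval_comp]

theorem eval_toRef_ref (i : Fin N) (p : ℝ[X]) (j : Fin (k + 2)) :
    (D.toRef i p).eval (D.ref i j) = p.eval (D.pt i j) := D.eval_toRef i p _

theorem eval_derivative_toRef (i : Fin N) (p : ℝ[X]) (y : ℝ) :
    (derivative (D.toRef i p)).eval y =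
      D.len i / 2 * (derivative p).eval (D.len i / 2 * y + (D.left i + D.right i) / 2) := by
  simp [toRef, derivative_comp, eval_comp]

theorem pt_zero (i : Fin N) : D.pt i 0 = D.left i := by
  rw [pt, (D.ref_spec i).first, len]; ring

theorem pt_last (i : Fin N) : D.pt i (Fin.last (k + 1)) = D.right i := by
  rw [pt, (D.ref_spec i).last, len]; ring

theorem pt_mem (i : Fin N) (j : Fin (k + 2)) : D.pt i j ∈ Icc (D.left i) (D.right i) := by
  obtain ⟨h1, h2⟩ := (D.ref_spec i).mem_Icc j
  have h := D.len_pos i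
  rw [len] at h
  constructor <;> rw [pt, len] <;> nlinarith

theorem eval_toRef_neg_one (i : Fin N) (p : ℝ[X]) :
    (D.toRef i p).eval (-1) = p.eval (D.left i) := by
  rw [← D.pt_zero, ← eval_toRef_ref, (D.ref_spec i).first]

theorem eval_toRef_one (i : Fin N) (p : ℝ[X]) :
    (D.toRef i p).eval 1 = p.eval (D.right i) := by
  rw [← D.pt_last, ← eval_toRef_ref, (D.ref_spec i).last]

theorem integral_pt (i : Fin N) (p : ℝ[X]) (j l : Fin (k + 2)) :
    ∫ x in (D.pt i j)..(D.pt i l), p.eval x =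
      D.len i / 2 * ∫ y in (D.ref i j)..(D.ref i l), (D.toRef i p).eval y := by
  simp only [eval_toRef]
  exact (intervalIntegral.mul_integral_comp_mul_add (f := fun x => p.eval x) _ _).symm

theorem star_eq_refStar (w : PiecewisePoly N) (i : Fin N) (j : Fin (k + 1)) :
    D.star w i j = refStar (D.family i) (D.ref i) (D.toRef i (w i)) j := by
  unfold star refStar
  rw [D.eval_toRef_neg_one]
  congr 1
  refine Finset.sum_congr rfl fun m _ => ?_
  rw [D.eval_derivative_toRef, pt]
  ring

/-- The squared `L²` norm of `v` on element `i`. -/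
def localSq (v : PiecewisePoly N) (i : Fin N) : ℝ :=
  D.len i / 2 * refIntegral (D.toRef i (v i) ^ 2)

theorem localSq_nonneg (v : PiecewisePoly N) (i : Fin N) : 0 ≤ D.localSq v i :=
  mul_nonneg (by linarith [D.len_pos i]) (refIntegral_sq_nonneg _)

theorem weightedSq_one (v : PiecewisePoly N) :
    D.weightedSq (fun _ => 1) v = ∑ i, D.localSq v i := by
  refine Finset.sum_congr rfl fun i _ => ?_
  have h := D.integral_pt i (v i ^ 2) 0 (Fin.last (k + 1))
  rw [D.pt_zero, D.pt_last, (D.ref_spec i).first, (D.ref_spec i).last] at h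
  simp only [eval_pow, one_mul] at h ⊢
  rw [h, localSq, refIntegral_apply, toRef, toRef, pow_comp]

theorem weightedSq_one_nonneg (v : PiecewisePoly N) : 0 ≤ D.weightedSq (fun _ => 1) v :=
  D.weightedSq_one v ▸ Finset.sum_nonneg fun i _ => D.localSq_nonneg v i

theorem l2Norm_sq (v : PiecewisePoly N) : D.l2Norm v ^ 2 = D.weightedSq (fun _ => 1) v :=
  Real.sq_sqrt (D.weightedSq_one_nonneg v)

/-- The form `(v, w*)` on `V_h`. -/
def massForm (v w : PiecewisePoly N) : ℝ :=
  D.innerConst (fun i x => (v i).eval x) (D.star w)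

theorem massForm_eq (v w : PiecewisePoly N) :
    D.massForm v w = ∑ i, D.len i / 2 *
      refMass (D.family i) (D.ref i) (D.toRef i (v i)) (D.toRef i (w i)) := by
  unfold massForm innerConst
  refine Finset.sum_congr rfl fun i _ => ?_
  rw [refMass, Finset.mul_sum]
  refine Finset.sum_congr rfl fun j _ => ?_
  rw [D.star_eq_refStar, D.integral_pt]
  ring

variable {D}

theorem massForm_comm (hk : 1 ≤ k) {v w : PiecewisePoly N} (hv : MemVh k v) (hw : MemVh k w) :
    D.massForm v w = D.massForm w v := by
  rw [massForm_eq, massForm_eq]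
  refine Finset.sum_congr rfl fun i _ => ?_
  obtain ⟨c, -, -, h, -⟩ := (D.ref_spec i).exists_refMass_eq hk
  rw [h _ _ ((D.natDegree_toRef_le i _).trans (hv i)) ((D.natDegree_toRef_le i _).trans (hw i)),
    h _ _ ((D.natDegree_toRef_le i _).trans (hw i)) ((D.natDegree_toRef_le i _).trans (hv i)),
    mul_comm (D.toRef i (v i)), mul_comm (coeff _ _)]

theorem weightedSq_one_le_massForm (hk : 1 ≤ k) {v : PiecewisePoly N} (hv : MemVh k v) :
    D.weightedSq (fun _ => 1) v ≤ D.massForm v v := by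
  rw [weightedSq_one, massForm_eq]
  refine Finset.sum_le_sum fun i _ => ?_
  obtain ⟨c, hc, -, h, -⟩ := (D.ref_spec i).exists_refMass_eq hk
  have hq := (D.natDegree_toRef_le i _).trans (hv i)
  have hlen := D.len_pos i
  rw [h _ _ hq hq, localSq, sq]
  gcongr
  exact le_add_of_nonneg_right (mul_nonneg hc (mul_self_nonneg _))

theorem massForm_nonneg (hk : 1 ≤ k) {v : PiecewisePoly N} (hv : MemVh k v) :
    0 ≤ D.massForm v v :=
  (D.weightedSq_one_nonneg v).trans (weightedSq_one_le_massForm hk hv)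

theorem massForm_le (hk : 1 ≤ k) {v : PiecewisePoly N} (hv : MemVh k v) :
    D.massForm v v ≤ 2 * D.weightedSq (fun _ => 1) v := by
  rw [weightedSq_one, massForm_eq, Finset.mul_sum]
  refine Finset.sum_le_sum fun i _ => ?_
  obtain ⟨c, -, -, h, h'⟩ := (D.ref_spec i).exists_refMass_eq hk
  have hq := (D.natDegree_toRef_le i _).trans (hv i)
  have hlen := D.len_pos i
  rw [h _ _ hq hq, localSq, ← sq, ← sq, mul_left_comm, two_mul]
  gcongr
  exact h' _ hq

/-- For Radau points in all elements, `(v, v*) = ‖v‖₀²`. -/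
theorem massForm_eq_weightedSq (hk : 1 ≤ k) (hD : ∀ i, D.family i ≠ .gauss)
    {v : PiecewisePoly N} (hv : MemVh k v) :
    D.massForm v v = D.weightedSq (fun _ => 1) v := by
  rw [weightedSq_one, massForm_eq]
  refine Finset.sum_congr rfl fun i _ => ?_
  obtain ⟨c, -, hc, h, -⟩ := (D.ref_spec i).exists_refMass_eq hk
  have hq := (D.natDegree_toRef_le i _).trans (hv i)
  rw [h _ _ hq hq, localSq, ← sq, hc (hD i), zero_mul, add_zero]

end Discretization

/-- In both schemes the energy is `(v, v*)`. -/
theorem Scheme.energyNorm_eq {k N : ℕ} (hk : 1 ≤ k) {α : ℝ → ℝ} {D : Discretization k N}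
    {σ : Scheme} (hσ : σ.Admits α D) {v : PiecewisePoly N} (hv : MemVh k v) :
    σ.energyNorm D v = √(D.massForm v v) := by
  cases σ
  · rw [Discretization.massForm_eq_weightedSq hk (fun i h => ?_) hv]
    · rfl
    · rcases (hσ i).1 with h' | h' <;> rw [h] at h' <;> cases h'
  · rfl

/-! ### The flux terms on one element -/

/-- The contribution to the energy balance of the flux at an end point, `A` being the quadrature
weight, `x` the derivative and `d` the difference of numerical flux and trace: it is controlled by
the dissipation `|a| d²` at the end point unless it vanishes. -/
theorem boundary_term_le {A x a d ε B : ℝ} (hA0 : 0 ≤ A) (hA2 : A ≤ 2) (hε : 0 ≤ ε)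
    (hx : x ^ 2 ≤ B) (h : A * (a * d) = 0 ∨ |a| ≤ ε) :
    A * (x * (a * d)) ≤ 1 / 4 * (|a| * d ^ 2) + 4 * ε * B := by
  have hB : 0 ≤ B := (sq_nonneg x).trans hx
  rcases h with h | h
  · rw [mul_left_comm, h]
    have := abs_nonneg a
    rw [mul_zero]
    positivity
  · calc A * (x * (a * d)) ≤ |A * (x * (a * d))| := le_abs_self _
      _ = A * (|a| * (|x| * |d|)) := by
        rw [abs_mul, abs_mul, abs_mul, abs_of_nonneg hA0]; ring
      _ ≤ 2 * (|a| * (|x| * |d|)) := by gcongr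
      _ = |a| * (2 * |x| * |d|) := by ring
      _ ≤ |a| * (4 * x ^ 2 + 1 / 4 * d ^ 2) := by
        gcongr
        nlinarith [sq_nonneg (2 * |x| - |d| / 2), sq_abs x, sq_abs d]
      _ = 4 * (|a| * x ^ 2) + 1 / 4 * (|a| * d ^ 2) := by ring
      _ ≤ 4 * (ε * B) + 1 / 4 * (|a| * d ^ 2) := by gcongr
      _ = 1 / 4 * (|a| * d ^ 2) + 4 * ε * B := by ring

/-- The flux terms of one element, up to dissipation at its end points and a remainder of the size
`ε` of the variation of the coefficient `a`. For constant `a` the interior terms would be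
`a ∫ q q' = a/2 [q²]`, since the quadrature is exact for `q q'`. -/
theorem neg_sum_refStar_flux_le {k : ℕ} (hk : 1 ≤ k) {F : NodeFamily} {s : Fin (k + 2) → ℝ}
    (hs : IsReferencePartition F s) {q : ℝ[X]} (hq : q.natDegree ≤ k) {B ε : ℝ} (hε : 0 ≤ ε)
    (hB : ∀ y ∈ Icc (-1 : ℝ) 1, q.eval y ^ 2 ≤ B ∧ (derivative q).eval y ^ 2 ≤ B)
    (a G : Fin (k + 2) → ℝ) (ha : ∀ j, |a j - a 0| ≤ ε) {ul ur : ℝ}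
    (hG0 : G 0 = a 0 * ul) (hG1 : G (Fin.last (k + 1)) = a (Fin.last (k + 1)) * ur)
    (hG : ∀ j, j ≠ 0 → j ≠ Fin.last (k + 1) → G j = a j * q.eval (s j))
    (hl : weight F s 0 * (a 0 * (ul - q.eval (-1))) = 0 ∨ |a 0| ≤ ε)
    (hr : weight F s (Fin.last (k + 1)) * (a (Fin.last (k + 1)) * (ur - q.eval 1)) = 0 ∨
      |a (Fin.last (k + 1))| ≤ ε) :
    -∑ j : Fin (k + 1), refStar F s q j * (G j.succ - G j.castSucc) ≤
      (a 0 * (q.eval (-1) * ul - 1 / 2 * q.eval (-1) ^ 2) +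
          1 / 4 * (|a 0| * (ul - q.eval (-1)) ^ 2)) -
        (a (Fin.last (k + 1)) * (q.eval 1 * ur - 1 / 2 * q.eval 1 ^ 2) -
          1 / 4 * (|a (Fin.last (k + 1))| * (ur - q.eval 1) ^ 2)) + 11 * ε * B := by
  have h01 : (0 : Fin (k + 2)) ≠ Fin.last (k + 1) := (Fin.last_pos).ne
  have hBl := hB (-1) (by norm_num)
  have hBr := hB 1 (by norm_num)
  have hB0 : 0 ≤ B := (sq_nonneg _).trans hBr.1
  set T0 := 1 / 4 * (|a 0| * (ul - q.eval (-1)) ^ 2) + 4 * ε * B with hT0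
  set T1 := 1 / 4 * (|a (Fin.last (k + 1))| * (ur - q.eval 1) ^ 2) + 4 * ε * B with hT1
  have hexact : quad F s (fun j => (derivative q * q).eval (s j)) =
      1 / 2 * (q.eval 1 ^ 2 - q.eval (-1) ^ 2) := by
    rw [hs.quad_eval]
    · have h := refIntegral_derivative (q * q)
      rw [derivative_mul, map_add, eval_mul, eval_mul, mul_comm q] at h
      linarith
    · have := natDegree_mul_le (p := derivative q) (q := q)
      have := natDegree_derivative_le q
      have := F.le_size k
      omega
  have hterm : ∀ j, weight F s j * ((derivative q).eval (s j) * G j) ≤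
      a 0 * (weight F s j * (derivative q * q).eval (s j)) + weight F s j * (ε * B) +
        ((if j = 0 then T0 else 0) + (if j = Fin.last (k + 1) then T1 else 0)) := by
    intro j
    have hA := hs.weight_nonneg hk j
    obtain ⟨h1, h2⟩ := hB (s j) (hs.mem_Icc j)
    -- variation of the coefficient
    have h3 : weight F s j * ((derivative q).eval (s j) * (a j * q.eval (s j))) ≤
        a 0 * (weight F s j * (derivative q * q).eval (s j)) + weight F s j * (ε * B) := by
      have h4 : (a j - a 0) * ((derivative q).eval (s j) * q.eval (s j)) ≤ ε * B := by
        refine (le_abs_self _).trans ?_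
        rw [abs_mul]
        refine mul_le_mul (ha j) ?_ (abs_nonneg _) hε
        rw [abs_le]
        constructor <;>
          nlinarith [sq_nonneg ((derivative q).eval (s j) - q.eval (s j)),
            sq_nonneg ((derivative q).eval (s j) + q.eval (s j))]
      have h5 := mul_le_mul_of_nonneg_left h4 hA
      rw [eval_mul]
      linarith
    rcases eq_or_ne j 0 with rfl | hj0
    · rw [if_pos rfl, if_neg h01, add_zero, hG0]
      rw [hs.first] at h2 h3 ⊢
      have := boundary_term_le hA (hs.weight_le_two hk 0) hε h2 hl
      linarith
    · rw [if_neg hj0, zero_add]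
      rcases eq_or_ne j (Fin.last (k + 1)) with rfl | hj1
      · rw [if_pos rfl, hG1]
        rw [hs.last] at h2 h3 ⊢
        have := boundary_term_le hA (hs.weight_le_two hk _) hε h2 hr
        linarith
      · rw [if_neg hj1, add_zero, hG j hj0 hj1]
        exact h3
  have hsum : quad F s (fun j => (derivative q).eval (s j) * G j) ≤
      a 0 * (1 / 2 * (q.eval 1 ^ 2 - q.eval (-1) ^ 2)) + 2 * (ε * B) + (T0 + T1) := by
    refine (Finset.sum_le_sum fun j _ => hterm j).trans_eq ?_
    rw [Finset.sum_add_distrib, Finset.sum_add_distrib, Finset.sum_add_distrib,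
      ← Finset.mul_sum, ← Finset.sum_mul, hs.sum_weight hk, ← hexact, quad]
    simp
  have hvar : a 0 * (1 / 2 * q.eval 1 ^ 2) ≤
      a (Fin.last (k + 1)) * (1 / 2 * q.eval 1 ^ 2) + ε * B := by
    have h1 := (abs_le.1 (ha (Fin.last (k + 1)))).1
    have h2 : ε * q.eval 1 ^ 2 ≤ ε * B := by gcongr; exact hBr.1
    nlinarith [sq_nonneg (q.eval 1), mul_nonneg hε (sq_nonneg (q.eval 1))]
  rw [hs.sum_refStar_mul_sub hk hq, hG0, hG1]
  linarith

/-! ### The flux terms on the whole mesh -/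

theorem exists_deriv_bound {α : ℝ → ℝ} (hα : ContDiff ℝ 1 α) (b : ℝ) :
    ∃ L : ℝ, 0 ≤ L ∧ (∀ x ∈ Icc 0 b, |deriv α x| ≤ L) ∧
      ∀ x ∈ Icc 0 b, ∀ y ∈ Icc 0 b, |α x - α y| ≤ L * |x - y| := by
  obtain ⟨L, hL⟩ := (isCompact_Icc (a := 0) (b := b)).exists_bound_of_continuousOn
    (hα.continuous_deriv le_rfl).continuousOn
  have h : ∀ x ∈ Icc 0 b, |deriv α x| ≤ max L 0 := fun x hx => (hL x hx).trans (le_max_left _ _)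
  refine ⟨max L 0, le_max_right _ _, h, fun x hx y hy => ?_⟩
  exact (convex_Icc 0 b).norm_image_sub_le_of_norm_deriv_le
    (fun z _ => (hα.differentiable one_ne_zero).differentiableAt) h hy hx

/-- At an interface with traces `m` and `p` from the left and the right, the upwind flux dissipates
`|a| (m - p)² / 2`, half of which absorbs the terms left over by the two adjacent elements. -/
theorem upwind_dissipation {a m p u : ℝ} (hu : u = if 0 < a then m else p) :
    (a * (p * u - 1 / 2 * p ^ 2) + 1 / 4 * (|a| * (u - p) ^ 2)) -
      (a * (m * u - 1 / 2 * m ^ 2) - 1 / 4 * (|a| * (u - m) ^ 2)) ≤ 0 := by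
  split_ifs at hu with h
  · rw [hu, abs_of_pos h]
    nlinarith [mul_nonneg h.le (sq_nonneg (m - p))]
  · rw [hu, abs_of_nonpos (not_lt.1 h)]
    nlinarith [mul_nonneg (neg_nonneg.2 (not_lt.1 h)) (sq_nonneg (m - p))]

theorem weight_zero_of_ne_leftRadau {k : ℕ} {F : NodeFamily} (hF : F ≠ .leftRadau)
    (s : Fin (k + 2) → ℝ) : weight F s 0 = 0 := by
  cases F <;> simp_all [weight, NodeFamily.indices]

theorem weight_last_of_ne_rightRadau {k : ℕ} {F : NodeFamily} (hF : F ≠ .rightRadau)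
    (s : Fin (k + 2) → ℝ) : weight F s (Fin.last (k + 1)) = 0 := by
  cases F <;> simp_all [weight, NodeFamily.indices]

namespace Discretization

variable {k N : ℕ} (D : Discretization k N)

theorem apply_left_add_one [NeZero N] {α : ℝ → ℝ} (hper : α 0 = α (2 * Real.pi)) (i : Fin N) :
    α (D.left (i + 1)) = α (D.right i) := by
  obtain ⟨n, rfl⟩ : ∃ n, N = n + 1 := ⟨N - 1, (Nat.succ_pred (NeZero.ne N)).symm⟩
  rcases eq_or_ne i (Fin.last n) with rfl | hi
  · rw [Fin.last_add_one, left, right, Fin.castSucc_zero, Fin.succ_last, D.node_first,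
      D.node_last, hper]
  · rw [left, right]
    congr 2
    ext
    rw [Fin.val_castSucc, Fin.val_add_one_of_lt (Fin.lt_last_iff_ne_last.2 hi), Fin.val_succ]

/-- The flux part `∑_{i,j} w*_{i,j} ((α v̂)(x_{i,j+1}) - (α v̂)(x_{i,j}))` of the form `a_h`. -/
def fluxForm [NeZero N] (α : ℝ → ℝ) (v : PiecewisePoly N) (w : PiecewiseConst k N) : ℝ :=
  ∑ i, ∑ j : Fin (k + 1), w i j * (D.flux α v i j.succ - D.flux α v i j.castSucc)

theorem form_eq [NeZero N] (α : ℝ → ℝ) (v vt : PiecewisePoly N) (w : PiecewiseConst k N) :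
    D.form α v vt w = D.innerConst (fun i x => (vt i).eval x) w + D.fluxForm α v w :=
  Finset.sum_add_distrib

variable {D}

/-- When right Radau points are used although the flux at the right end is taken from the right
neighbour, `α` has a zero in the element; likewise for left Radau points. -/
theorem abs_le_of_admits {α : ℝ → ℝ} {σ : Scheme} (hσ : σ.Admits α D) (i : Fin N) {ε : ℝ}
    (hε : |α (D.right i) - α (D.left i)| ≤ ε) :
    (D.family i = .rightRadau → α (D.right i) ≤ 0 → |α (D.right i)| ≤ ε) ∧
      (D.family i = .leftRadau → 0 < α (D.left i) → |α (D.left i)| ≤ ε) := by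
  have hε' := abs_le.1 hε
  cases σ
  · obtain ⟨-, h1, h2⟩ := hσ i
    refine ⟨fun hF hr => ?_, fun hF hl => ?_⟩
    · rw [abs_of_nonpos hr]
      rcases hr.eq_or_lt with h | h
      · rw [h]; linarith [abs_nonneg (α (D.right i) - α (D.left i))]
      · have : 0 ≤ α (D.left i) := not_lt.1 fun h' => by
          have := h2 h' h
          rw [hF] at this
          cases this
        linarith
    · have : α (D.right i) ≤ 0 := not_lt.1 fun h' => by
        have := h1 hl h'
        rw [hF] at this
        cases this
      rw [abs_of_pos hl]
      linarith
  · constructor <;> intro hF <;> rw [hσ i] at hF <;> cases hF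

/-- The negative flux part of `a_h(v, v*)` is bounded by the squared `L²` norm, uniformly over all
meshes, shape-regular or not. -/
theorem exists_neg_fluxForm_le (hk : 1 ≤ k) {α : ℝ → ℝ} (hα : ContDiff ℝ 1 α)
    (hper : α 0 = α (2 * Real.pi)) :
    ∃ C : ℝ, 0 ≤ C ∧ ∀ (N : ℕ) [NeZero N] (D : Discretization k N) (σ : Scheme),
      σ.Admits α D → ∀ v : PiecewisePoly N, MemVh k v →
        -D.fluxForm α v (D.star v) ≤ C * D.weightedSq (fun _ => 1) v := by
  obtain ⟨L, hL, -, hLip⟩ := exists_deriv_bound hα (2 * Real.pi)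
  obtain ⟨K, hK, hinv⟩ := exists_eval_sq_le k
  refine ⟨22 * L * K, by positivity, fun N _ D σ hσ v hv => ?_⟩
  -- the boundary terms of element `i` at its left and right ends
  set lt : Fin N → ℝ := fun i =>
    α (D.left i) * ((v i).eval (D.left i) * D.upwind α v (i - 1) -
      1 / 2 * (v i).eval (D.left i) ^ 2) +
      1 / 4 * (|α (D.left i)| * (D.upwind α v (i - 1) - (v i).eval (D.left i)) ^ 2) with hlt
  set rt : Fin N → ℝ := fun i =>
    α (D.right i) * ((v i).eval (D.right i) * D.upwind α v i -
      1 / 2 * (v i).eval (D.right i) ^ 2) -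
      1 / 4 * (|α (D.right i)| * (D.upwind α v i - (v i).eval (D.right i)) ^ 2) with hrt
  have helem : ∀ i, -∑ j : Fin (k + 1), D.star v i j *
      (D.flux α v i j.succ - D.flux α v i j.castSucc) ≤
        lt i - rt i + 22 * L * K * D.localSq v i := by
    intro i
    have hlen := D.len_pos i
    have hsub : ∀ x ∈ Icc (D.left i) (D.right i), x ∈ Icc 0 (2 * Real.pi) := fun x hx =>
      ⟨(D.node_mem _).1.trans hx.1, hx.2.trans (D.node_mem _).2⟩
    have hvar : ∀ x ∈ Icc (D.left i) (D.right i), |α x - α (D.left i)| ≤ L * D.len i := by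
      intro x hx
      refine (hLip x (hsub x hx) _ (hsub _ (left_mem_Icc.2 (D.left_lt_right i).le))).trans ?_
      rw [abs_of_nonneg (sub_nonneg.2 hx.1), len]
      gcongr
      exact hx.2
    have hdeg := (D.natDegree_toRef_le i (v i)).trans (hv i)
    have hadm := abs_le_of_admits hσ i (hvar _ (right_mem_Icc.2 (D.left_lt_right i).le))
    have hleft : α (D.left i) ≤ 0 → D.upwind α v (i - 1) = (v i).eval (D.left i) := by
      intro h
      have h1 := D.apply_left_add_one hper (i - 1)
      rw [sub_add_cancel] at h1
      rw [upwind, if_neg (by rw [← h1]; exact not_lt.2 h), sub_add_cancel]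
    have h := neg_sum_refStar_flux_le hk (D.ref_spec i) hdeg
      (mul_nonneg hL hlen.le) (hinv _ hdeg) (fun j => α (D.pt i j)) (D.flux α v i)
      (fun j => by rw [D.pt_zero]; exact hvar _ (D.pt_mem i j))
      (ul := D.upwind α v (i - 1)) (ur := D.upwind α v i)
      (by rw [flux, if_pos rfl, D.pt_zero])
      (by rw [flux, if_neg (Fin.last_pos).ne', if_pos rfl, D.pt_last])
      (fun j h0 h1 => by rw [flux, if_neg h0, if_neg h1, D.eval_toRef_ref])
      (by
        rw [D.pt_zero, D.eval_toRef_neg_one]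
        by_cases hF : D.family i = .leftRadau
        · rcases le_or_gt (α (D.left i)) 0 with h | h
          · left; rw [hleft h]; ring
          · right; exact hadm.2 hF h
        · left; rw [weight_zero_of_ne_leftRadau hF, zero_mul])
      (by
        rw [D.pt_last, D.eval_toRef_one]
        by_cases hF : D.family i = .rightRadau
        · rcases le_or_gt (α (D.right i)) 0 with h | h
          · right; exact hadm.1 hF h
          · left; rw [upwind, if_pos h]; ring
        · left; rw [weight_last_of_ne_rightRadau hF, zero_mul])
    simp only [D.pt_zero, D.pt_last, D.eval_toRef_one, D.eval_toRef_neg_one] at h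
    simp only [D.star_eq_refStar]
    refine h.trans_eq ?_
    simp only [hlt, hrt, localSq]
    ring
  -- the left ends are reindexed, so as to collect the terms of each interface
  have hinter : ∑ i, (lt i - rt i) ≤ 0 := by
    rw [Finset.sum_sub_distrib, ← Equiv.sum_comp (Equiv.addRight (1 : Fin N)) lt,
      ← Finset.sum_sub_distrib]
    refine Finset.sum_nonpos fun i _ => ?_
    simp only [hlt, hrt, Equiv.coe_addRight, add_sub_cancel_right, D.apply_left_add_one hper i]
    exact upwind_dissipation rfl
  rw [weightedSq_one, Finset.mul_sum, fluxForm, ← Finset.sum_neg_distrib]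
  refine (Finset.sum_le_sum fun i _ => helem i).trans ?_
  rw [Finset.sum_add_distrib]
  linarith

theorem abs_weightedSq_le {c : ℝ → ℝ} {L : ℝ}
    (hL : ∀ x ∈ Icc 0 (2 * Real.pi), |c x| ≤ L) (v : PiecewisePoly N) :
    |D.weightedSq (c) v| ≤ L * D.weightedSq (fun _ => 1) v := by
  rw [weightedSq, weightedSq, Finset.mul_sum]
  refine (Finset.abs_sum_le_sum_abs _ _).trans (Finset.sum_le_sum fun i _ => ?_)
  have hle := (D.left_lt_right i).le
  have hv := (v i).continuous
  rw [← intervalIntegral.integral_const_mul, ← Real.norm_eq_abs]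
  refine intervalIntegral.norm_integral_le_of_norm_le hle (Filter.Eventually.of_forall ?_)
    ((by fun_prop : Continuous fun x => L * (1 * (v i).eval x ^ 2)).intervalIntegrable _ _)
  intro x hx
  rw [norm_mul, Real.norm_eq_abs, Real.norm_eq_abs, abs_of_nonneg (sq_nonneg (eval x (v i))),
    one_mul]
  gcongr
  exact hL x ⟨(D.node_mem _).1.trans hx.1.le, hx.2.trans (D.node_mem _).2⟩

end Discretization

/-! ### Time derivatives -/

theorem linearMap_apply_eq_sum_coeff (l : ℝ[X] →ₗ[ℝ] ℝ) {p : ℝ[X]} {k : ℕ}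
    (hp : p.natDegree ≤ k) : l p = ∑ m ∈ Finset.range (k + 1), p.coeff m * l (X ^ m) := by
  conv_lhs => rw [as_sum_range_C_mul_X_pow' (p := p) (n := k + 1) (by omega)]
  simp [← smul_eq_C_mul]

/-- A linear functional commutes with the time derivative of a polynomial of bounded degree. -/
theorem hasDerivWithinAt_linearMap (l : ℝ[X] →ₗ[ℝ] ℝ) {k : ℕ} {p : ℝ → ℝ[X]} {p' : ℝ[X]}
    {S : Set ℝ} {t : ℝ} (ht : t ∈ S) (hp : ∀ s ∈ S, (p s).natDegree ≤ k)
    (hp' : p'.natDegree ≤ k)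
    (h : ∀ m, HasDerivWithinAt (fun s => (p s).coeff m) (p'.coeff m) S t) :
    HasDerivWithinAt (fun s => l (p s)) (l p') S t := by
  rw [linearMap_apply_eq_sum_coeff l hp']
  refine HasDerivWithinAt.congr (f := fun s =>
    ∑ m ∈ Finset.range (k + 1), (p s).coeff m * l (X ^ m)) ?_
    (fun s hs => linearMap_apply_eq_sum_coeff l (hp s hs))
    (linearMap_apply_eq_sum_coeff l (hp t ht))
  exact HasDerivWithinAt.fun_sum fun m _ => (h m).mul_const _

namespace Discretization

variable {k N : ℕ} {D : Discretization k N}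

/-- The value `w*_{i,j}`, as a linear functional of the polynomial `w` on element `i`. -/
def starFunctional (D : Discretization k N) (i : Fin N) (j : Fin (k + 1)) : ℝ[X] →ₗ[ℝ] ℝ :=
  leval (D.left i) + ∑ m ∈ Finset.Iic j,
    (D.len i / 2 * weight (D.family i) (D.ref i) m.castSucc) •
      (leval (D.pt i m.castSucc) ∘ₗ derivative)

theorem starFunctional_apply (i : Fin N) (j : Fin (k + 1)) (w : PiecewisePoly N) :
    D.starFunctional i j (w i) = D.star w i j := by
  simp [starFunctional, star]

/-- The integral over a control volume, as a linear functional. -/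
def cellIntegral (D : Discretization k N) (i : Fin N) (j : Fin (k + 1)) : ℝ[X] →ₗ[ℝ] ℝ where
  toFun p := ∫ x in (D.pt i j.castSucc)..(D.pt i j.succ), p.eval x
  map_add' p q := by
    simp only [eval_add]
    exact intervalIntegral.integral_add (p.continuous.intervalIntegrable _ _)
      (q.continuous.intervalIntegrable _ _)
  map_smul' c p := by
    simp only [eval_smul, smul_eq_mul, RingHom.id_apply]
    exact intervalIntegral.integral_const_mul _ _

theorem massForm_eq_sum (v w : PiecewisePoly N) : D.massForm v w =
    ∑ i, ∑ j, D.starFunctional i j (w i) * D.cellIntegral i j (v i) := by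
  simp only [starFunctional_apply]
  rfl

theorem hasDerivWithinAt_massForm (hk : 1 ≤ k) {u : ℝ → PiecewisePoly N} {ut : PiecewisePoly N}
    {S : Set ℝ} {t : ℝ} (ht : t ∈ S) (hu : ∀ s ∈ S, MemVh k (u s)) (hut : MemVh k ut)
    (h : ∀ i m, HasDerivWithinAt (fun s => (u s i).coeff m) ((ut i).coeff m) S t) :
    HasDerivWithinAt (fun s => D.massForm (u s) (u s)) (2 * D.massForm ut (u t)) S t := by
  have hd : ∀ i (l : ℝ[X] →ₗ[ℝ] ℝ), HasDerivWithinAt (fun s => l (u s i)) (l (ut i)) S t :=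
    fun i l => hasDerivWithinAt_linearMap l ht (fun s hs => hu s hs i) (hut i) (h i)
  have h2 : 2 * D.massForm ut (u t) = ∑ i, ∑ j,
      (D.starFunctional i j (ut i) * D.cellIntegral i j (u t i) +
        D.starFunctional i j (u t i) * D.cellIntegral i j (ut i)) := by
    simp only [Finset.sum_add_distrib, ← massForm_eq_sum]
    rw [massForm_comm hk (hu t ht) hut]
    ring
  rw [h2]
  simp only [massForm_eq_sum]
  exact HasDerivWithinAt.fun_sum fun i _ => HasDerivWithinAt.fun_sum fun j _ =>
    (hd i _).mul (hd i _)

namespace IsSolution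

variable [NeZero N] {α : ℝ → ℝ} {T : ℝ} {g : ℝ → ℝ → ℝ} {u ut : ℝ → PiecewisePoly N}

/-- The time derivative of a solution is in `V_h`. -/
theorem memVh_deriv (hu : D.IsSolution α T g u ut) (hT : 0 < T) {t : ℝ} (ht : t ∈ Icc 0 T) :
    MemVh k (ut t) := fun i => by
  refine natDegree_le_iff_coeff_eq_zero.2 fun m hm => ?_
  have hz : ∀ s ∈ Icc 0 T, (u s i).coeff m = 0 := fun s hs =>
    coeff_eq_zero_of_natDegree_lt ((hu.mem s hs i).trans_lt hm)
  have h0 : HasDerivWithinAt (fun s => (u s i).coeff m) 0 (Icc 0 T) t :=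
    (hasDerivWithinAt_const t _ (0 : ℝ)).congr hz (hz t ht)
  exact (uniqueDiffOn_Icc hT t ht).eq_deriv _ (hu.hasDeriv t ht i m) h0

theorem hasDerivWithinAt_massForm (hk : 1 ≤ k) (hu : D.IsSolution α T g u ut) (hT : 0 < T)
    {t : ℝ} (ht : t ∈ Icc 0 T) :
    HasDerivWithinAt (fun s => D.massForm (u s) (u s)) (2 * D.massForm (ut t) (u t))
      (Icc 0 T) t :=
  Discretization.hasDerivWithinAt_massForm hk ht hu.mem (hu.memVh_deriv hT ht) (hu.hasDeriv t ht)

end IsSolution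

end Discretization

/-- Gronwall's inequality in the form `f' ≤ K f`. -/
theorem le_exp_mul_of_deriv_le {f f' : ℝ → ℝ} {K T : ℝ}
    (hf : ∀ t ∈ Icc 0 T, HasDerivWithinAt f (f' t) (Icc 0 T) t)
    (hle : ∀ t ∈ Icc 0 T, f' t ≤ K * f t) {t : ℝ} (ht : t ∈ Icc 0 T) :
    f t ≤ Real.exp (K * t) * f 0 := by
  have hexp : ∀ s : ℝ, HasDerivAt (fun s => Real.exp (-(K * s))) (Real.exp (-(K * s)) * -K) s := by
    intro s
    simpa using (((hasDerivAt_id s).const_mul K).neg).exp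
  have hprod : ∀ s ∈ Icc 0 T, HasDerivWithinAt (fun s => Real.exp (-(K * s)) * f s)
      (Real.exp (-(K * s)) * -K * f s + Real.exp (-(K * s)) * f' s) (Icc 0 T) s := fun s hs =>
    (hexp s).hasDerivWithinAt.mul (hf s hs)
  have hanti : AntitoneOn (fun s => Real.exp (-(K * s)) * f s) (Icc 0 T) := by
    refine antitoneOn_of_hasDerivWithinAt_nonpos (convex_Icc 0 T)
      (fun s hs => (hprod s hs).continuousWithinAt)
      (fun s hs => (hprod s (interior_subset hs)).mono interior_subset) fun s hs => ?_
    have h := mul_le_mul_of_nonneg_left (hle s (interior_subset hs)) (Real.exp_pos (-(K * s))).le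
    linarith
  have h0 : (0 : ℝ) ∈ Icc 0 T := ⟨le_rfl, ht.1.trans ht.2⟩
  have h := hanti h0 ht ht.1
  simp only [mul_zero, neg_zero, Real.exp_zero, one_mul] at h
  calc f t = Real.exp (K * t) * (Real.exp (-(K * t)) * f t) := by
        rw [← mul_assoc, ← Real.exp_add, add_neg_cancel, Real.exp_zero, one_mul]
    _ ≤ Real.exp (K * t) * f 0 := by gcongr

end SV

end

/-! ### Norm equivalence, energy inequality and stability -/

theorem theorem3p2 (σ : SV.Scheme) (k : ℕ) (hk : 1 ≤ k) (α : ℝ → ℝ) (hα : ContDiff ℝ 1 α)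
    (hper : α 0 = α (2 * Real.pi)) (ρ : ℝ) :
    -- the energy norm is equivalent to the `L²` norm
    (∃ C : ℝ, ∀ (N : ℕ) [NeZero N] (D : SV.Discretization k N),
      σ.Admits α D → ∀ v : SV.PiecewisePoly N, SV.MemVh k v →
        D.l2Norm v ≤ C * σ.energyNorm D v ∧ σ.energyNorm D v ≤ C * D.l2Norm v) ∧
    -- the energy inequality
    (∃ C : ℝ, ∀ (N : ℕ) [NeZero N] (D : SV.Discretization k N),
      D.ShapeRegular ρ → σ.Admits α D →
      ∀ T : ℝ, 0 < T → ∀ g : ℝ → ℝ → ℝ,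
        (∀ t ∈ Icc 0 T,
          IntervalIntegrable (fun x => g x t) MeasureTheory.volume 0 (2 * Real.pi)) →
      ∀ u ut : ℝ → SV.PiecewisePoly N, D.IsSolution α T g u ut →
      ∀ t ∈ Icc 0 T,
        DifferentiableWithinAt ℝ (fun s => σ.energyNorm D (u s) ^ 2) (Icc 0 T) t ∧
        1 / 2 * derivWithin (fun s => σ.energyNorm D (u s) ^ 2) (Icc 0 T) t ≤
          -(1 / 2) * D.weightedSq (deriv α) (u t) + D.form α (u t) (ut t) (D.star (u t)) +
            C * D.l2Norm (u t) ^ 2) ∧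
    -- stability, in the absence of a source term
    (∀ T : ℝ, 0 < T → ∃ C : ℝ, ∀ (N : ℕ) [NeZero N] (D : SV.Discretization k N),
      D.ShapeRegular ρ → σ.Admits α D →
      ∀ u ut : ℝ → SV.PiecewisePoly N, D.IsSolution α T (fun _ _ => 0) u ut →
      ∀ t ∈ Icc 0 T,
        σ.energyNorm D (u t) ≤ C * σ.energyNorm D (u 0)) := by
  refine ⟨⟨2, fun N _ D hσ v hv => ?_⟩, ?_⟩
  · have h1 := SV.Discretization.weightedSq_one_le_massForm (D := D) hk hv
    have h2 := SV.Discretization.massForm_le (D := D) hk hv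
    have h0 := D.weightedSq_one_nonneg v
    rw [SV.Scheme.energyNorm_eq hk hσ hv, SV.Discretization.l2Norm]
    constructor
    · refine (Real.sqrt_le_sqrt h1).trans ?_
      linarith [Real.sqrt_nonneg (D.massForm v v)]
    · rw [Real.sqrt_le_left (by positivity), mul_pow, Real.sq_sqrt h0]
      linarith
  obtain ⟨K, hK, hflux⟩ := SV.Discretization.exists_neg_fluxForm_le hk hα hper
  obtain ⟨L, hL, hderiv, -⟩ := SV.exists_deriv_bound hα (2 * Real.pi)
  -- the time derivative of the energy, and its estimate
  have henergy : ∀ (N : ℕ) [NeZero N] (D : SV.Discretization k N), σ.Admits α D →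
      ∀ T : ℝ, 0 < T → ∀ (g : ℝ → ℝ → ℝ) (u ut : ℝ → SV.PiecewisePoly N),
        D.IsSolution α T g u ut → ∀ t ∈ Icc 0 T,
          HasDerivWithinAt (fun s => σ.energyNorm D (u s) ^ 2)
            (2 * D.massForm (ut t) (u t)) (Icc 0 T) t ∧
          D.massForm (ut t) (u t) ≤ -(1 / 2) * D.weightedSq (deriv α) (u t) +
            D.form α (u t) (ut t) (D.star (u t)) + (K + L) * D.l2Norm (u t) ^ 2 := by
    intro N _ D hσ T hT g u ut hu t ht
    have hE : ∀ s ∈ Icc 0 T, σ.energyNorm D (u s) ^ 2 = D.massForm (u s) (u s) := fun s hs => by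
      rw [SV.Scheme.energyNorm_eq hk hσ (hu.mem s hs),
        Real.sq_sqrt (SV.Discretization.massForm_nonneg hk (hu.mem s hs))]
    refine ⟨(hu.hasDerivWithinAt_massForm hk hT ht).congr hE (hE t ht), ?_⟩
    have h1 := hflux N D σ hσ (u t) (hu.mem t ht)
    have h2 := abs_le.1 (SV.Discretization.abs_weightedSq_le (D := D) hderiv (u t))
    have h3 := mul_nonneg hL (D.weightedSq_one_nonneg (u t))
    rw [D.form_eq, D.l2Norm_sq]
    change D.massForm (ut t) (u t) ≤ _ + (D.massForm (ut t) (u t) + _) + _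
    linarith
  refine ⟨⟨K + L, fun N _ D _ hσ T hT g _ u ut hu t ht => ?_⟩, fun T hT => ?_⟩
  · obtain ⟨h1, h2⟩ := henergy N D hσ T hT g u ut hu t ht
    refine ⟨h1.differentiableWithinAt, ?_⟩
    rw [h1.derivWithin (uniqueDiffOn_Icc hT t ht)]
    linarith
  · refine ⟨Real.exp ((K + 2 * L) * T), fun N _ D _ hσ u ut hu t ht => ?_⟩
    have hnonneg : ∀ v : SV.PiecewisePoly N, 0 ≤ σ.energyNorm D v := fun v => by
      cases σ <;> exact Real.sqrt_nonneg _
    have hd := fun s hs => henergy N D hσ T hT _ u ut hu s hs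
    have hgron := SV.le_exp_mul_of_deriv_le (K := 2 * (K + 2 * L)) (fun s hs => (hd s hs).1)
      (fun s hs => ?_) ht
    · refine abs_le_of_sq_le_sq' ?_ (mul_nonneg (Real.exp_pos _).le (hnonneg _)) |>.2
      refine hgron.trans ?_
      rw [mul_pow, ← Real.exp_nat_mul]
      refine mul_le_mul_of_nonneg_right (Real.exp_le_exp.2 ?_) (sq_nonneg _)
      push_cast
      have := mul_le_mul_of_nonneg_left ht.2 (by positivity : 0 ≤ K + 2 * L)
      linarith
    · -- the scheme tested with `u*`
      have hform : D.form α (u s) (ut s) (D.star (u s)) = 0 := by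
        rw [hu.scheme s hs, SV.Discretization.innerConst]
        simp
      have h1 := (hd s hs).2
      have h2 := abs_le.1 (SV.Discretization.abs_weightedSq_le (D := D) hderiv (u s))
      have h3 := SV.Discretization.weightedSq_one_le_massForm (D := D) hk (hu.mem s hs)
      have h0 := D.weightedSq_one_nonneg (u s)
      have h4 := mul_le_mul_of_nonneg_left h3 (by positivity : 0 ≤ K + 2 * L)
      have h5 := mul_nonneg hL h0
      rw [hform, D.l2Norm_sq] at h1
      rw [SV.Scheme.energyNorm_eq hk hσ (hu.mem s hs),
        Real.sq_sqrt (SV.Discretization.massForm_nonneg hk (hu.mem s hs))]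
      linarith
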